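/- Let $f=(A,B,C)$ denote the integral binary quadratic form $Ax^2+Bxy+Cy^2$, let $\Delta=B^2-4AC$ be its discriminant, and assume that $\Delta>0$ and that $\Delta$ is not a perfect square. The group $\mathrm{PSL}_2(\mathbf Z)$ acts on forms by $U\cdot f:=f(U(x,y)^t)$; $[f]$ is the orbit of $f$ and $\mathrm{Aut}(f)$ its stabilizer. A form $(a,b,c)$ in $[f]$ is called *reduced* (in the sense of Gauss) if $\bigl|\sqrt\Delta-2|a|\bigr|<b<\sqrt\Delta$. Let $S(z)=-1/z$ and $R(z)=(z-1)/z$. The bipartite Farey tree $\mathcal F$ is the ribbon graph with edges $\{W\}$, $W\in\mathrm{PSL}_2(\mathbf Z)$, with $\otimes$-vertices $\{W,WS\}$ and $\bullet$-vertices $\{W,WR,WR^2\}$ (in this cyclic order), where an edge joins the two vertices that contain it. The *çark* of $f$ is the quotient graph $\mathrm{Aut}(f)\backslash\mathcal F$ by left multiplication. Its *spine* is its circuit, that is, the set of edges that lie on a circuit. At each $\bullet$-vertex of the spine one edge is not on the spine; there a *Farey branch* is attached. For $M=\begin{pmatrix}p&q\\ r&s\end{pmatrix}$ hyperbolic put $f_M=\frac{\mathrm{sgn}(p+s)}{\gcd(q,s-p,r)}(r,s-p,-q)$,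 and direct the spine from each edge $\mathrm{Aut}(f)W$ towards the translate $MW$ of its lift $W$, where $M\in\mathrm{Aut}(f)$ is hyperbolic and $f$ is a positive integer multiple of $f_M$ (so $f_M=f$ if $f$ is primitive). The çark is embedded in the annulus $\mathrm{Aut}(f)\backslash\mathcal H$ with its usual orientation and the directed spine running counterclockwise, so that the inner boundary component is on the left of the spine. Thus, if the directed spine enters a $\bullet$-vertex by the edge $\mathrm{Aut}(f)W$, the branch there points toward the inner boundary if it is attached by $\mathrm{Aut}(f)WR$, and toward the outer boundary if it is attached by $\mathrm{Aut}(f)WR^2$. A *Farey component* is a maximal run of consecutive $\bullet$-vertices of the spine whose branches point toward the same boundary component. An edge of the spine is called *reduced* if it lies on either side of a Farey component pointing toward the inner boundary, that is, if its $\bullet$-vertex belongs to such a component while the next $\bullet$-vertex of the spine beyond its $\otimes$-vertex does not. **Theorem.** The labelling $\mathrm{Aut}(f)\,W\mapsto W\cdot f$ of the edges of the çark of $f$ by forms in $[f]$ restricts to a bijection from the set of reduced edges of the çark onto the set of reduced forms in $[f]$. -/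

import Mathlib

open scoped MatrixGroups

namespace Cark

/-! ### Integral binary quadratic forms -/

/-- The integral binary quadratic form `A x² + B x y + C y²`. -/
@[ext]
structure BQF where
  A : ℤ
  B : ℤ
  C : ℤ

namespace BQF

/-- The discriminant `B² - 4AC`. -/
def disc (f : BQF) : ℤ := f.B ^ 2 - 4 * f.A * f.C

/-- The form `(x, y) ↦ f (U (x, y)ᵗ)`. -/
def comp (f : BQF) (U : SL(2, ℤ)) : BQF where
  A := f.A * U 0 0 ^ 2 + f.B * (U 0 0 * U 1 0) + f.C * U 1 0 ^ 2
  B := 2 * f.A * (U 0 0 * U 0 1) + f.B * (U 0 0 * U 1 1 + U 0 1 * U 1 0)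
    + 2 * f.C * (U 1 0 * U 1 1)
  C := f.A * U 0 1 ^ 2 + f.B * (U 0 1 * U 1 1) + f.C * U 1 1 ^ 2

theorem comp_one (f : BQF) : f.comp 1 = f := by
  ext <;> simp [comp]

theorem comp_mul (f : BQF) (U V : SL(2, ℤ)) : f.comp (U * V) = (f.comp U).comp V := by
  ext <;> simp [comp, Matrix.mul_apply, Fin.sum_univ_two] <;> ring

theorem comp_center (f : BQF) {U : SL(2, ℤ)} (hU : U ∈ Subgroup.center SL(2, ℤ)) :
    f.comp U = f := by
  obtain ⟨r, hr, h⟩ := Matrix.SpecialLinearGroup.mem_center_iff.1 hU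
  have hr2 : r ^ 2 = 1 := by simpa using hr
  rw [Matrix.scalar_apply] at h
  have h00 : U 0 0 = r := by simpa using (congrFun (congrFun h 0) 0).symm
  have h01 : U 0 1 = 0 := by simpa using (congrFun (congrFun h 0) 1).symm
  have h10 : U 1 0 = 0 := by simpa using (congrFun (congrFun h 1) 0).symm
  have h11 : U 1 1 = r := by simpa using (congrFun (congrFun h 1) 1).symm
  have hrr : r * r = 1 := by rw [← hr2]; ring
  ext <;> simp [comp, h00, h01, h10, h11, hr2, hrr]

/-- The action `(f, U) ↦ U · f = f (U (x, y)ᵗ)` of `PSL₂(ℤ)` on forms. -/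
def act (f : BQF) (U : PSL(2, ℤ)) : BQF :=
  Quotient.liftOn' U f.comp (fun a b hab => by
    have h := QuotientGroup.leftRel_apply.1 hab
    have hb : b = a * (a⁻¹ * b) := by group
    rw [hb, comp_mul, comp_center _ h])

@[simp]
theorem act_mk (f : BQF) (U : SL(2, ℤ)) : f.act (U : PSL(2, ℤ)) = f.comp U := rfl

theorem act_one (f : BQF) : f.act 1 = f := comp_one f

theorem act_mul (f : BQF) (U V : PSL(2, ℤ)) : f.act (U * V) = (f.act U).act V := by
  induction U using QuotientGroup.induction_on with
  | H u =>
    induction V using QuotientGroup.induction_on with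
    | H v => exact comp_mul f u v

/-- The class `[f]`, that is the `PSL₂(ℤ)`-orbit of `f`. -/
def formClass (f : BQF) : Set BQF := {g | ∃ U : PSL(2, ℤ), g = f.act U}

/-- The automorphism group of `f`, that is its stabilizer in `PSL₂(ℤ)`. -/
def aut (f : BQF) : Subgroup PSL(2, ℤ) where
  carrier := {U | f.act U = f}
  one_mem' := act_one f
  mul_mem' := by
    intro a b ha hb
    simp only [Set.mem_ofPred_eq] at ha hb ⊢
    rw [act_mul, ha, hb]
  inv_mem' := by
    intro a ha
    simp only [Set.mem_ofPred_eq] at ha ⊢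
    calc f.act a⁻¹ = (f.act a).act a⁻¹ := by rw [ha]
      _ = f := by rw [← act_mul, mul_inv_cancel, act_one]

/-- Gauss's notion of a reduced (indefinite) form. -/
def IsReduced (f : BQF) : Prop :=
  abs (√(f.disc : ℝ) - 2 * abs (f.A : ℝ)) < f.B ∧ (f.B : ℝ) < √(f.disc : ℝ)

end BQF

/-- The form `f_M = sgn(p + s) / gcd(q, s - p, r) · (r, s - p, -q)` attached to
`M = (p, q; r, s)`. Its roots `x / y` are the fixed points of `M`, and it does not change when `M`
is replaced by `-M`, while `M⁻¹` yields `-f_M`. -/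
def formOfMatrix (M : SL(2, ℤ)) : BQF where
  A := (M 0 0 + M 1 1).sign * M 1 0 / Int.gcd (M 0 1) (Int.gcd (M 1 1 - M 0 0) (M 1 0))
  B := (M 0 0 + M 1 1).sign * (M 1 1 - M 0 0) / Int.gcd (M 0 1) (Int.gcd (M 1 1 - M 0 0) (M 1 0))
  C := (M 0 0 + M 1 1).sign * (-M 0 1) / Int.gcd (M 0 1) (Int.gcd (M 1 1 - M 0 0) (M 1 0))

/-! ### The bipartite Farey tree and its quotients -/

/-- The elliptic element `z ↦ -1 / z` of order two. -/
def S : PSL(2, ℤ) := (ModularGroup.S : SL(2, ℤ))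

/-- The matrix `(1, -1; 1, 0)`. -/
def matR : SL(2, ℤ) := ⟨!![1, -1; 1, 0], by simp⟩

/-- The elliptic element `z ↦ (z - 1) / z` of order three. -/
def R : PSL(2, ℤ) := matR

section ModularGraph

variable (Γ : Subgroup PSL(2, ℤ))

/-- The edges `Γ · {W}` of the modular graph `Γ \ ℱ`. -/
def Edge : Type := Quotient (QuotientGroup.rightRel Γ)

/-- The vertices `Γ · {W, WS}` of type `⊗`. -/
def CrossVertex : Type :=
  DoubleCoset.Quotient (Γ : Set PSL(2, ℤ)) (Subgroup.zpowers S : Set PSL(2, ℤ))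

/-- The vertices `Γ · {W, WR, WR²}` of type `•`. -/
def BulletVertex : Type :=
  DoubleCoset.Quotient (Γ : Set PSL(2, ℤ)) (Subgroup.zpowers R : Set PSL(2, ℤ))

variable {Γ}

/-- The edge `Γ · {W}`. -/
def Edge.mk (W : PSL(2, ℤ)) : Edge Γ := Quotient.mk (QuotientGroup.rightRel Γ) W

/-- The edge `Γ · {WU}`, for the edge `e = Γ · {W}`. Thus `e` and `e.next S` are the edges at the
`⊗`-vertex of `e`, and `e`, `e.next R`, `e.next (R ^ 2)` are the edges at the `•`-vertex of `e`, in
the cyclic order of the ribbon graph. -/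
def Edge.next (e : Edge Γ) (U : PSL(2, ℤ)) : Edge Γ :=
  Quotient.liftOn e (fun W => Edge.mk (W * U)) (fun a b hab => by
    have h := QuotientGroup.rightRel_apply.1 hab
    refine Quotient.sound (QuotientGroup.rightRel_apply.2 ?_)
    have h2 : b * U * (a * U)⁻¹ = b * a⁻¹ := by group
    rw [h2]
    exact h)

/-- The `⊗`-vertex of an edge. -/
def Edge.cross (e : Edge Γ) : CrossVertex Γ :=
  Quotient.liftOn e (fun W => DoubleCoset.mk Γ (Subgroup.zpowers S) W) (fun a b hab => by
    have h := QuotientGroup.rightRel_apply.1 hab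
    exact (DoubleCoset.eq _ _ _ _).2 ⟨b * a⁻¹, h, 1, one_mem _, by group⟩)

/-- The `•`-vertex of an edge. -/
def Edge.bullet (e : Edge Γ) : BulletVertex Γ :=
  Quotient.liftOn e (fun W => DoubleCoset.mk Γ (Subgroup.zpowers R) W) (fun a b hab => by
    have h := QuotientGroup.rightRel_apply.1 hab
    exact (DoubleCoset.eq _ _ _ _).2 ⟨b * a⁻¹, h, 1, one_mem _, by group⟩)

variable (Γ)

/-- The underlying graph of the modular graph `Γ \ ℱ`: the edge `e` joins its `⊗`-vertex to its
`•`-vertex. (Two distinct edges with the same ends would give a parabolic or elliptic element of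
`Γ`; there are none in a çark.) -/
def modularGraph : SimpleGraph (CrossVertex Γ ⊕ BulletVertex Γ) where
  Adj x y := ∃ e : Edge Γ,
    (x = Sum.inl e.cross ∧ y = Sum.inr e.bullet) ∨ (x = Sum.inr e.bullet ∧ y = Sum.inl e.cross)
  symm := ⟨by
    rintro x y ⟨e, h | h⟩
    · exact ⟨e, Or.inr ⟨h.2, h.1⟩⟩
    · exact ⟨e, Or.inl ⟨h.2, h.1⟩⟩⟩
  loopless := ⟨by
    rintro x ⟨e, ⟨h, h'⟩ | ⟨h, h'⟩⟩ <;> simp [h] at h'⟩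

variable {Γ}

/-- The edge lies on the spine, that is on a circuit of the graph. -/
def Edge.OnSpine (e : Edge Γ) : Prop :=
  ∃ (v : CrossVertex Γ ⊕ BulletVertex Γ) (c : (modularGraph Γ).Walk v v),
    c.IsCycle ∧ s(Sum.inl e.cross, Sum.inr e.bullet) ∈ c.edges

end ModularGraph

/-! ### The directed çark of a form, and its embedding in the annulus -/

section Form

variable (f : BQF)

/-- The label of the edge `Aut(f) · {W}` of the çark `Aut(f) \ ℱ` of `f`: the form `W · f`. -/
def edgeForm (e : Edge f.aut) : BQF :=
  Quotient.liftOn e f.act (fun a b hab => by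
    have h : f.act (b * a⁻¹) = f := QuotientGroup.rightRel_apply.1 hab
    have hb : b = b * a⁻¹ * a := by group
    rw [hb, BQF.act_mul, h])

/-- `M` is a hyperbolic automorphism of `f` that belongs to `f` itself (and not to `-f`), that is
`f_M = f`, up to the content of `f` if `f` is not primitive. The spine of the çark of `f` is
directed from any edge towards its translates by such `M`. -/
def IsPositiveAut (M : PSL(2, ℤ)) : Prop :=
  M ∈ f.aut ∧ ∃ m : SL(2, ℤ), (m : PSL(2, ℤ)) = M ∧ ∃ d : ℤ, 0 < d ∧
    f = ⟨d * (formOfMatrix m).A, d * (formOfMatrix m).B, d * (formOfMatrix m).C⟩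

/-- The directed spine runs through `e` from its `⊗`-vertex to its `•`-vertex: in the Farey tree, a
path that leaves the edge `W` over `e` through its `•`-vertex, then passes to `WR` or `WR²`, through
the `⊗`-vertex there to `WRS` or `WR²S`, and so on without backtracking, arrives at `MW`, where `M`
is a positive automorphism. -/
def TowardBullet (e : Edge f.aut) : Prop :=
  ∃ W M : PSL(2, ℤ), e = Edge.mk W ∧ IsPositiveAut f M ∧
    ∃ w ∈ Submonoid.closure ({R * S, R ^ 2 * S} : Set PSL(2, ℤ)), M * W = W * w

/-- The two boundary components of the annulus `Aut(f) \ ℍ`. -/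
inductive Boundary where
  | inner
  | outer

/-- At the `•`-vertex `v` of the spine, the Farey branch attached to `v` points towards the given
boundary component. The çark is embedded in the annulus in the usual orientation, its directed spine
running counterclockwise, so that the inner boundary is on the left of the spine and the outer one
on the right. If the spine enters `v` by the edge `e`, then `e.next R` is on the left and
`e.next (R ^ 2)` on the right (`R` acts on the upper half plane as a clockwise rotation about its
fixed point); one of them carries the spine on and the other one is the branch. -/
def BranchToward (b : Boundary) (v : BulletVertex f.aut) : Prop :=
  ∃ e : Edge f.aut, e.bullet = v ∧ e.OnSpine ∧ TowardBullet f e ∧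
    match b with
    | Boundary.inner => ¬ (e.next R).OnSpine
    | Boundary.outer => ¬ (e.next (R ^ 2)).OnSpine

/-- `v` and `w` are consecutive `•`-vertices of the spine (the edges `e` and `e.next S` of the spine
join them to the `⊗`-vertex between them), with branches in the direction of the same boundary
component `b`. -/
def Consecutive (b : Boundary) (v w : BulletVertex f.aut) : Prop :=
  BranchToward f b v ∧ BranchToward f b w ∧
    ∃ e : Edge f.aut, e.OnSpine ∧ e.bullet = v ∧ (e.next S).bullet = w

/-- `K` is (the set of `•`-vertices of) a Farey component in the direction of `b`: a maximal run of
consecutive vertices of the spine with branches in the direction of `b`. -/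
def IsFareyComponent (b : Boundary) (K : Set (BulletVertex f.aut)) : Prop :=
  ∃ v, BranchToward f b v ∧ K = {w | Relation.ReflTransGen (Consecutive f b) v w}

/-- A reduced edge: an edge of the spine on either side of a Farey component in the direction of the
inner boundary, that is, an edge that joins a vertex of the component to a `⊗`-vertex beyond which
the component does not continue. -/
def IsReducedEdge (e : Edge f.aut) : Prop :=
  e.OnSpine ∧ ∃ K, IsFareyComponent f Boundary.inner K ∧ e.bullet ∈ K ∧ (e.next S).bullet ∉ K

end Form

end Cark

/-! Because `Aut(f)` is the stabilizer of `f`, the labelling is injective on edges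
(`edgeForm_injective`) and its image is all of `[f]`. It remains to see that an edge is reduced
exactly when its label is (`isReducedEdge_iff`), and both sides turn into sign conditions on
Conway's topograph.

A label `(a, b, c)` records the values `a` and `c`, with third value `a + b + c` at the `•`-vertex.
`R` permutes these three values and `S` yields `(c, -b, a)`, so the third value at the `•`-vertex
beyond the `⊗`-vertex is `a - b + c`. No such value is zero, since `Δ` is not a square.

The dictionary is as follows. Gauss reduction means `a * c < 0`, `a + b + c > 0` and `a - b + c < 0`
(`BQF.isReduced_iff`). The spine is Conway's river, `a * c < 0` (`onSpine_iff`): river edges are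
finitely many and form periodic orbits, while off the river the middle coefficient grows
monotonically and forbids a circuit. The spine is directed from `⊗` to `•` iff `a > 0 > c`
(`towardBullet_iff`), by conjugating a hyperbolic automorphism into the monoid of nonnegative
matrices. Hence a branch points inward iff two of the three values at its vertex are positive
(`branchToward_inner_iff`). So a reduced edge is a river edge with `a + b + c > 0` at its own vertex
and `a - b + c < 0` at the next one. -/

namespace Cark

/-! ### Nonvanishing values and Gauss reduction as a sign condition -/

namespace BQF

theorem disc_comp (f : BQF) (U : SL(2, ℤ)) : (f.comp U).disc = f.disc := by
  have h : U 0 0 * U 1 1 - U 0 1 * U 1 0 = 1 := by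
    rw [← Matrix.det_fin_two]; exact U.2
  have h2 : (f.comp U).disc = f.disc * (U 0 0 * U 1 1 - U 0 1 * U 1 0) ^ 2 := by
    simp only [disc, comp]; ring
  rw [h2, h]; ring

theorem disc_act (f : BQF) (U : PSL(2, ℤ)) : (f.act U).disc = f.disc := by
  induction U using QuotientGroup.induction_on with
  | H u => exact disc_comp f u

/-- A zero outer coefficient would make the discriminant equal to `B²`. This is what makes all sign
distinctions strict. -/
theorem A_ne_zero {f : BQF} (h : ¬ IsSquare f.disc) : f.A ≠ 0 := fun hA =>
  h ⟨f.B, by simp [disc, hA, sq]⟩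

theorem C_ne_zero {f : BQF} (h : ¬ IsSquare f.disc) : f.C ≠ 0 := fun hC =>
  h ⟨f.B, by simp [disc, hC, sq]⟩

theorem act_S (f : BQF) : f.act S = ⟨f.C, -f.B, f.A⟩ := by
  change f.comp ModularGroup.S = _
  ext <;> simp [comp, ModularGroup.S]

theorem act_R (f : BQF) : f.act R = ⟨f.A + f.B + f.C, -2 * f.A - f.B, f.A⟩ := by
  change f.comp matR = _
  ext <;> simp [comp, matR]
  ring

theorem act_R_sq (f : BQF) : f.act (R ^ 2) = ⟨f.C, -f.B - 2 * f.C, f.A + f.B + f.C⟩ := by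
  rw [sq, act_mul, act_R, act_R]
  ext <;> simp <;> ring

theorem add_add_ne_zero {f : BQF} (h : ¬ IsSquare f.disc) : f.A + f.B + f.C ≠ 0 := by
  have := A_ne_zero (f := f.act R) (by rwa [disc_act])
  rwa [act_R] at this

/-- Used with `α = |A|`, `γ = |C|`, `r = √Δ`. It rests on `(2α + b)² - r² = 4α(α + b - γ)` and `r² -
(2α - b)² = 4α(γ + b - α)`; the bound `b < r` follows from `αγ > 0`. -/
theorem abs_sqrt_sub_lt_iff {α γ b r : ℝ} (hα : 0 < α) (hγ : 0 < γ) (hr : 0 ≤ r)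
    (h : r ^ 2 = b ^ 2 + 4 * α * γ) : (|r - 2 * α| < b ∧ b < r) ↔ |α - γ| < b := by
  constructor
  · rintro ⟨h1, h2⟩
    have hb : 0 < b := (abs_nonneg _).trans_lt h1
    rw [abs_lt] at h1 ⊢
    obtain ⟨h3, h4⟩ := h1
    constructor
    · by_contra! h5
      have h6 : r ^ 2 < (2 * α + b) ^ 2 := pow_lt_pow_left₀ (by linarith) hr two_ne_zero
      nlinarith [mul_le_mul_of_nonneg_left h5 hα.le]
    · by_contra! h5
      have h6 : r ^ 2 ≤ (2 * α - b) ^ 2 := by nlinarith [mul_le_mul_of_nonneg_left h5 hα.le]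
      have h7 : r ≤ 2 * α - b := le_of_sq_le_sq h6 (by linarith)
      linarith
  · intro h1
    have hb : 0 < b := (abs_nonneg _).trans_lt h1
    have hbr : b < r := lt_of_pow_lt_pow_left₀ 2 hr (by nlinarith [mul_pos hα hγ])
    rw [abs_lt] at h1 ⊢
    obtain ⟨h3, h4⟩ := h1
    refine ⟨⟨?_, ?_⟩, hbr⟩
    · by_contra! h5
      have h6 : r ^ 2 ≤ (2 * α - b) ^ 2 := pow_le_pow_left₀ hr (by linarith) 2
      nlinarith [mul_pos hα (sub_pos.2 h4)]
    · by_contra! h5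
      have h6 : (2 * α + b) ^ 2 ≤ r ^ 2 := pow_le_pow_left₀ (by linarith) (by linarith) 2
      nlinarith [mul_pos hα (sub_pos.2 h3)]

/-- A form is reduced iff its first and last coefficients have opposite signs and its values at
`(1, 1)` and `(1, -1)` are positive and negative. -/
theorem isReduced_iff {f : BQF} (hf : 0 < f.disc) (h : ¬ IsSquare f.disc) :
    f.IsReduced ↔ f.A * f.C < 0 ∧ 0 < f.A + f.B + f.C ∧ f.A - f.B + f.C < 0 := by
  have hdisc : (f.disc : ℝ) = (f.B : ℝ) ^ 2 - 4 * f.A * f.C := by simp [disc]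
  have hsq : √(f.disc : ℝ) ^ 2 = (f.B : ℝ) ^ 2 - 4 * f.A * f.C := by
    rw [Real.sq_sqrt (by exact_mod_cast hf.le), hdisc]
  have key : f.A * f.C < 0 → (f.IsReduced ↔ |(|(f.A : ℝ)| - |(f.C : ℝ)|)| < f.B) := by
    intro hAC
    have hAC' : (f.A : ℝ) * f.C < 0 := by exact_mod_cast hAC
    refine abs_sqrt_sub_lt_iff (abs_pos.2 (by exact_mod_cast A_ne_zero h))
      (abs_pos.2 (by exact_mod_cast C_ne_zero h)) (Real.sqrt_nonneg _) ?_
    rw [hsq, mul_assoc 4 |(f.A : ℝ)|, ← abs_mul, abs_of_neg hAC']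
    ring
  have key2 : f.A * f.C < 0 → |(|(f.A : ℝ)| - |(f.C : ℝ)|)| = |(f.A : ℝ) + f.C| := by
    intro hAC
    rcases mul_neg_iff.1 hAC with ⟨h1, h2⟩ | ⟨h1, h2⟩
    · rw [abs_of_pos (a := (f.A : ℝ)) (by exact_mod_cast h1),
        abs_of_neg (a := (f.C : ℝ)) (by exact_mod_cast h2), sub_neg_eq_add]
    · rw [abs_of_neg (a := (f.A : ℝ)) (by exact_mod_cast h1),
        abs_of_pos (a := (f.C : ℝ)) (by exact_mod_cast h2), ← abs_neg]
      congr 1; ring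
  have key3 : |(f.A : ℝ) + f.C| < f.B ↔ 0 < f.A + f.B + f.C ∧ f.A - f.B + f.C < 0 := by
    have : |(f.A : ℝ) + f.C| < f.B ↔ |f.A + f.C| < f.B := by exact_mod_cast Iff.rfl
    rw [this, abs_lt]
    constructor <;> rintro ⟨h1, h2⟩ <;> constructor <;> linarith
  constructor
  · intro hred
    -- Reducedness gives `0 ≤ B < √Δ`, and squaring leaves `B² < B² - 4AC`.
    have hAC : f.A * f.C < 0 := by
      obtain ⟨h1, h2⟩ := hred
      have h3 := pow_lt_pow_left₀ h2 ((abs_nonneg _).trans h1.le) two_ne_zero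
      rw [hsq] at h3
      have : (f.A : ℝ) * f.C < 0 := by linarith
      exact_mod_cast this
    exact ⟨hAC, key3.1 (key2 hAC ▸ (key hAC).1 hred)⟩
  · rintro ⟨hAC, h2⟩
    rw [key hAC, key2 hAC, key3]
    exact h2

end BQF

/-! ### Edges, their vertices and their labels -/

section Edges

variable {Γ : Subgroup PSL(2, ℤ)}

theorem R_pow_three : R ^ 3 = 1 := by
  have h : R ^ 3 = ((matR ^ 3 : SL(2, ℤ)) : PSL(2, ℤ)) := rfl
  rw [h, QuotientGroup.eq_one_iff, Matrix.SpecialLinearGroup.mem_center_iff]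
  refine ⟨-1, by simp, ?_⟩
  ext i j
  fin_cases i <;> fin_cases j <;> decide

theorem S_sq : S ^ 2 = 1 := by
  have h : S ^ 2 = ((ModularGroup.S ^ 2 : SL(2, ℤ)) : PSL(2, ℤ)) := rfl
  rw [h, QuotientGroup.eq_one_iff, Matrix.SpecialLinearGroup.mem_center_iff]
  refine ⟨-1, by simp, ?_⟩
  ext i j
  fin_cases i <;> fin_cases j <;> decide

namespace Edge

theorem exists_mk (e : Edge Γ) : ∃ W, e = Edge.mk W := by
  induction e using Quotient.ind with
  | _ W => exact ⟨W, rfl⟩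

@[simp]
theorem next_mk (W U : PSL(2, ℤ)) : (Edge.mk W : Edge Γ).next U = Edge.mk (W * U) := rfl

theorem mk_eq_mk {V W : PSL(2, ℤ)} : (Edge.mk V : Edge Γ) = Edge.mk W ↔ W * V⁻¹ ∈ Γ := by
  rw [← QuotientGroup.rightRel_apply]
  exact Quotient.eq

@[simp]
theorem next_next (e : Edge Γ) (U V : PSL(2, ℤ)) : (e.next U).next V = e.next (U * V) := by
  obtain ⟨W, rfl⟩ := e.exists_mk
  simp [mul_assoc]

@[simp]
theorem next_one (e : Edge Γ) : e.next 1 = e := by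
  obtain ⟨W, rfl⟩ := e.exists_mk
  simp

theorem next_S_S (e : Edge Γ) : (e.next S).next S = e := by
  rw [next_next, ← sq, S_sq, next_one]

theorem cross_eq_iff_exists_zpow {e e' : Edge Γ} :
    e.cross = e'.cross ↔ ∃ n : ℤ, e' = e.next (S ^ n) := by
  obtain ⟨V, rfl⟩ := e.exists_mk
  obtain ⟨W, rfl⟩ := e'.exists_mk
  refine (DoubleCoset.eq Γ (Subgroup.zpowers S) V W).trans ?_
  constructor
  · rintro ⟨h, hh, k, ⟨n, rfl⟩, rfl⟩
    refine ⟨n, ?_⟩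
    rw [next_mk, mk_eq_mk]
    have : V * S ^ n * (h * V * S ^ n)⁻¹ = h⁻¹ := by group
    simpa [this] using hh
  · rintro ⟨n, hn⟩
    rw [next_mk, eq_comm, mk_eq_mk] at hn
    exact ⟨_, hn, S ^ n, ⟨n, rfl⟩, by group⟩

theorem bullet_eq_iff_exists_zpow {e e' : Edge Γ} :
    e.bullet = e'.bullet ↔ ∃ n : ℤ, e' = e.next (R ^ n) := by
  obtain ⟨V, rfl⟩ := e.exists_mk
  obtain ⟨W, rfl⟩ := e'.exists_mk
  refine (DoubleCoset.eq Γ (Subgroup.zpowers R) V W).trans ?_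
  constructor
  · rintro ⟨h, hh, k, ⟨n, rfl⟩, rfl⟩
    refine ⟨n, ?_⟩
    rw [next_mk, mk_eq_mk]
    have : V * R ^ n * (h * V * R ^ n)⁻¹ = h⁻¹ := by group
    simpa [this] using hh
  · rintro ⟨n, hn⟩
    rw [next_mk, eq_comm, mk_eq_mk] at hn
    exact ⟨_, hn, R ^ n, ⟨n, rfl⟩, by group⟩

theorem cross_eq_iff {e e' : Edge Γ} : e.cross = e'.cross ↔ e' = e ∨ e' = e.next S := by
  rw [cross_eq_iff_exists_zpow]
  constructor
  · rintro ⟨n, rfl⟩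
    rcases Int.even_or_odd' n with ⟨k, rfl | rfl⟩
    · left; rw [zpow_mul, zpow_ofNat, S_sq, one_zpow, next_one]
    · right; rw [zpow_add, zpow_mul, zpow_ofNat, S_sq, one_zpow, one_mul, zpow_one]
  · rintro (rfl | rfl)
    · exact ⟨0, by simp⟩
    · exact ⟨1, by simp⟩

theorem bullet_eq_iff {e e' : Edge Γ} :
    e.bullet = e'.bullet ↔ e' = e ∨ e' = e.next R ∨ e' = e.next (R ^ 2) := by
  rw [bullet_eq_iff_exists_zpow]
  constructor
  · rintro ⟨n, rfl⟩
    have h : R ^ n = R ^ (n % 3) := by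
      conv_lhs => rw [← Int.emod_add_mul_ediv n 3, zpow_add, zpow_mul, zpow_ofNat R 3, R_pow_three,
        one_zpow, mul_one]
    have h0 := Int.emod_nonneg n (b := 3) (by norm_num)
    have h1 := Int.emod_lt_of_pos n (b := 3) (by norm_num)
    rw [h]
    generalize n % 3 = k at h0 h1
    interval_cases k
    · left; simp
    · right; left; simp
    · right; right; rw [zpow_ofNat]
  · rintro (rfl | rfl | rfl)
    · exact ⟨0, by simp⟩
    · exact ⟨1, by simp⟩
    · exact ⟨2, by rw [zpow_ofNat]⟩

theorem cross_next_S (e : Edge Γ) : (e.next S).cross = e.cross :=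
  (cross_eq_iff.2 (Or.inr rfl)).symm

theorem bullet_next_R (e : Edge Γ) : (e.next R).bullet = e.bullet :=
  (bullet_eq_iff.2 (Or.inr (Or.inl rfl))).symm

theorem bullet_next_R_sq (e : Edge Γ) : (e.next (R ^ 2)).bullet = e.bullet :=
  (bullet_eq_iff.2 (Or.inr (Or.inr rfl))).symm

end Edge

theorem modularGraph_adj_cross_bullet (e : Edge Γ) :
    (modularGraph Γ).Adj (Sum.inl e.cross) (Sum.inr e.bullet) := ⟨e, Or.inl ⟨rfl, rfl⟩⟩

/-- An edge lies on a circuit iff it is not a bridge. -/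
theorem Edge.onSpine_iff_reachable (e : Edge Γ) :
    e.OnSpine ↔ (modularGraph Γ \ SimpleGraph.fromEdgeSet
      {s(Sum.inl e.cross, Sum.inr e.bullet)}).Reachable (Sum.inl e.cross) (Sum.inr e.bullet) :=
  SimpleGraph.adj_and_reachable_delete_edges_iff_exists_cycle.symm.trans
    (and_iff_right (modularGraph_adj_cross_bullet e))

end Edges

/-! ### Labels of neighbouring edges -/

section Labels

variable {f : BQF}

theorem edgeForm_mk (W : PSL(2, ℤ)) : edgeForm f (Edge.mk W) = f.act W := rfl

theorem edgeForm_next (e : Edge f.aut) (U : PSL(2, ℤ)) :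
    edgeForm f (e.next U) = (edgeForm f e).act U := by
  obtain ⟨W, rfl⟩ := e.exists_mk
  exact f.act_mul W U

theorem edgeForm_injective : Function.Injective (edgeForm f) := by
  intro e e' h
  obtain ⟨V, rfl⟩ := e.exists_mk
  obtain ⟨W, rfl⟩ := e'.exists_mk
  rw [edgeForm_mk, edgeForm_mk] at h
  rw [Edge.mk_eq_mk]
  change f.act (W * V⁻¹) = f
  rw [BQF.act_mul, ← h, ← BQF.act_mul, mul_inv_cancel, BQF.act_one]

theorem disc_edgeForm (e : Edge f.aut) : (edgeForm f e).disc = f.disc := by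
  obtain ⟨W, rfl⟩ := e.exists_mk
  exact f.disc_act W

theorem edgeForm_next_S (e : Edge f.aut) : edgeForm f (e.next S) =
    ⟨(edgeForm f e).C, -(edgeForm f e).B, (edgeForm f e).A⟩ := by
  rw [edgeForm_next, BQF.act_S]

theorem edgeForm_next_R (e : Edge f.aut) : edgeForm f (e.next R) =
    ⟨(edgeForm f e).A + (edgeForm f e).B + (edgeForm f e).C,
      -2 * (edgeForm f e).A - (edgeForm f e).B, (edgeForm f e).A⟩ := by
  rw [edgeForm_next, BQF.act_R]

theorem edgeForm_next_R_sq (e : Edge f.aut) : edgeForm f (e.next (R ^ 2)) =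
    ⟨(edgeForm f e).C, -(edgeForm f e).B - 2 * (edgeForm f e).C,
      (edgeForm f e).A + (edgeForm f e).B + (edgeForm f e).C⟩ := by
  rw [edgeForm_next, BQF.act_R_sq]

theorem edgeForm_next_RS (e : Edge f.aut) : edgeForm f (e.next (R * S)) =
    ⟨(edgeForm f e).A, (edgeForm f e).B + 2 * (edgeForm f e).A,
      (edgeForm f e).A + (edgeForm f e).B + (edgeForm f e).C⟩ := by
  rw [← Edge.next_next, edgeForm_next_S, edgeForm_next_R]
  ext <;> simp

theorem edgeForm_next_R_sq_S (e : Edge f.aut) : edgeForm f (e.next (R ^ 2 * S)) =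
    ⟨(edgeForm f e).A + (edgeForm f e).B + (edgeForm f e).C,
      (edgeForm f e).B + 2 * (edgeForm f e).C, (edgeForm f e).C⟩ := by
  rw [← Edge.next_next, edgeForm_next_S, edgeForm_next_R_sq]
  ext <;> simp
  ring

/-- A çark has no multiple edges. -/
theorem Edge.eq_of_cross_eq_of_bullet_eq (hsq : ¬ IsSquare f.disc) {e e' : Edge f.aut}
    (hc : e.cross = e'.cross) (hb : e.bullet = e'.bullet) : e' = e := by
  have hA := BQF.A_ne_zero (f := edgeForm f e) (by rwa [disc_edgeForm])
  have hC := BQF.C_ne_zero (f := edgeForm f e) (by rwa [disc_edgeForm])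
  rcases Edge.cross_eq_iff.1 hc with h | h
  · exact h
  rcases Edge.bullet_eq_iff.1 hb with h' | h' | h'
  · exact h'
  -- Comparing middle coefficients of `eS = eR` forces `A = 0`; in the other case `eS = eR²` forces
  -- `C = 0`.
  · have := congrArg BQF.B (congrArg (edgeForm f) (h.symm.trans h'))
    rw [edgeForm_next_S, edgeForm_next_R] at this
    simp only at this
    omega
  · have := congrArg BQF.B (congrArg (edgeForm f) (h.symm.trans h'))
    rw [edgeForm_next_S, edgeForm_next_R_sq] at this
    simp only at this
    omega

end Labels

/-! ### The spine is the river -/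

section Spine

variable {f : BQF}

theorem adj_sdiff_of_ne (hsq : ¬ IsSquare f.disc) {e d : Edge f.aut} (h : d ≠ e) :
    (modularGraph f.aut \ SimpleGraph.fromEdgeSet
      {s(Sum.inl e.cross, Sum.inr e.bullet)}).Adj (Sum.inl d.cross) (Sum.inr d.bullet) := by
  rw [SimpleGraph.sdiff_adj]
  refine ⟨modularGraph_adj_cross_bullet d, fun h' => h ?_⟩
  rw [SimpleGraph.fromEdgeSet_adj] at h'
  have := h'.1
  simp only [Set.mem_singleton_iff, Sym2.eq_iff, Sum.inl.injEq, Sum.inr.injEq, reduceCtorEq,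
    and_false, or_false] at this
  exact Edge.eq_of_cross_eq_of_bullet_eq hsq this.1.symm this.2.symm

/-- The edge after `e` on the spine, for an edge `e` of the spine that is left through its
`•`-vertex. -/
def flow (e : Edge f.aut) : Edge f.aut :=
  if 0 < (edgeForm f e).A * ((edgeForm f e).A + (edgeForm f e).B + (edgeForm f e).C) then
    e.next (R ^ 2 * S)
  else e.next (R * S)

variable (f) in
/-- The edges labelled by forms whose outer coefficients have opposite signs. -/
def river : Set (Edge f.aut) := {e | (edgeForm f e).A * (edgeForm f e).C < 0}

theorem mem_river {e : Edge f.aut} :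
    e ∈ river f ↔ (edgeForm f e).A * (edgeForm f e).C < 0 := Iff.rfl

/-- On the river `Δ = B² + 4|A||C|` is a sum of nonnegative terms, which bounds every coefficient by
`Δ`. -/
theorem finite_river : (river f).Finite := by
  refine Set.Finite.of_finite_image (f := edgeForm f) ?_ edgeForm_injective.injOn
  let D := f.disc
  have : (Set.Icc (-D) D ×ˢ Set.Icc (-D) D ×ˢ Set.Icc (-D) D).Finite :=
    (Set.finite_Icc _ _).prod ((Set.finite_Icc _ _).prod (Set.finite_Icc _ _))
  refine (this.image fun p => (⟨p.1, p.2.1, p.2.2⟩ : BQF)).subset ?_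
  rintro _ ⟨e, he, rfl⟩
  refine ⟨((edgeForm f e).A, (edgeForm f e).B, (edgeForm f e).C), ?_, rfl⟩
  have hD : D = (edgeForm f e).B ^ 2 - 4 * (edgeForm f e).A * (edgeForm f e).C :=
    (disc_edgeForm e).symm
  rw [mem_river] at he
  generalize (edgeForm f e).A = a at *
  generalize (edgeForm f e).B = b at *
  generalize (edgeForm f e).C = c at *
  clear_value D
  simp only [Set.mem_prod, Set.mem_Icc, ← abs_le]
  have hac : |a| * |c| = -(a * c) := by rw [← abs_mul, abs_of_neg he]
  have ha : 0 < |a| := abs_pos.2 (by rintro rfl; simp at he)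
  have hc : 0 < |c| := abs_pos.2 (by rintro rfl; simp at he)
  have hb : |b| ≤ b ^ 2 := by
    rw [← sq_abs]
    exact Int.le_self_sq _
  refine ⟨?_, ?_, ?_⟩ <;> nlinarith [sq_nonneg b]

theorem flow_cases (hsq : ¬ IsSquare f.disc) (e : Edge f.aut) :
    (0 < (edgeForm f e).A * ((edgeForm f e).A + (edgeForm f e).B + (edgeForm f e).C) ∧
      flow e = e.next (R ^ 2 * S)) ∨
    ((edgeForm f e).A * ((edgeForm f e).A + (edgeForm f e).B + (edgeForm f e).C) < 0 ∧
      flow e = e.next (R * S)) := by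
  have hA := BQF.A_ne_zero (f := edgeForm f e) (by rwa [disc_edgeForm])
  have hs := BQF.add_add_ne_zero (f := edgeForm f e) (by rwa [disc_edgeForm])
  unfold flow
  split_ifs with h
  · exact Or.inl ⟨h, rfl⟩
  · exact Or.inr ⟨lt_of_le_of_ne (not_lt.1 h) (mul_ne_zero hA hs), rfl⟩

theorem mul_neg_of_mul_pos_of_mul_neg {a b c : ℤ} (h : 0 < a * b) (h' : a * c < 0) :
    b * c < 0 := by
  rcases mul_pos_iff.1 h with ⟨h1, h2⟩ | ⟨h1, h2⟩ <;>
    rcases mul_neg_iff.1 h' with ⟨h3, h4⟩ | ⟨h3, h4⟩ <;> nlinarith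

theorem mapsTo_flow (hsq : ¬ IsSquare f.disc) : Set.MapsTo flow (river f) (river f) := by
  intro e he
  rw [mem_river] at he ⊢
  rcases flow_cases hsq e with ⟨h, h'⟩ | ⟨h, h'⟩
  · rw [h', edgeForm_next_R_sq_S]
    exact mul_neg_of_mul_pos_of_mul_neg h he
  · rwa [h', edgeForm_next_RS]

theorem mul_A_flow_pos (hsq : ¬ IsSquare f.disc) (e : Edge f.aut) :
    0 < (edgeForm f e).A * (edgeForm f (flow e)).A := by
  rcases flow_cases hsq e with ⟨h, h'⟩ | ⟨h, h'⟩
  · rwa [h', edgeForm_next_R_sq_S]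
  · rw [h', edgeForm_next_RS]
    exact mul_self_pos.2 (BQF.A_ne_zero (by rwa [disc_edgeForm]))

/-- Preimages of one edge under different turns would be two edges at the same `•`-vertex, whose
third edge is on the river too; but three values cannot have pairwise opposite signs. -/
theorem injOn_flow (hsq : ¬ IsSquare f.disc) : Set.InjOn flow (river f) := by
  intro e he e' he' h
  rw [mem_river] at he he'
  apply edgeForm_injective
  have h := congrArg (edgeForm f) h
  rcases flow_cases hsq e with ⟨h1, h2⟩ | ⟨h1, h2⟩ <;>
    rcases flow_cases hsq e' with ⟨h3, h4⟩ | ⟨h3, h4⟩ <;>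
    rw [h2, h4] at h <;>
    simp only [edgeForm_next_RS, edgeForm_next_R_sq_S, BQF.mk.injEq] at h
  · ext <;> linarith [h.1, h.2.1, h.2.2]
  · obtain ⟨h5, h6, h7⟩ := h
    have h8 : (edgeForm f e).A = (edgeForm f e').C := by linarith
    rw [h5, h8] at h1
    linarith [mul_comm (edgeForm f e').A (edgeForm f e').C]
  · obtain ⟨h5, h6, h7⟩ := h
    have h8 : (edgeForm f e').A = (edgeForm f e).C := by linarith
    rw [← h5, h8] at h3
    linarith [mul_comm (edgeForm f e).A (edgeForm f e).C]
  · ext <;> linarith [h.1, h.2.1, h.2.2]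

/-- An injective self-map of a finite set has only periodic points. -/
theorem exists_iterate_flow_eq (hsq : ¬ IsSquare f.disc) {e : Edge f.aut} (he : e ∈ river f) :
    ∃ n, 0 < n ∧ flow^[n] e = e := by
  have := (finite_river (f := f)).to_subtype
  obtain ⟨n, hn, h⟩ := ((mapsTo_flow hsq).restrict_inj.2 (injOn_flow hsq)).mem_periodicPts ⟨e, he⟩
  refine ⟨n, hn, ?_⟩
  have := congrArg Subtype.val h
  rwa [(mapsTo_flow hsq).iterate_restrict] at this

theorem bullet_next_S_flow (e : Edge f.aut) :
    ((flow e).next S).bullet = e.bullet := by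
  unfold flow
  split_ifs
  · rw [← Edge.next_next, Edge.next_S_S, Edge.bullet_next_R_sq]
  · rw [← Edge.next_next, Edge.next_S_S, Edge.bullet_next_R]

theorem onSpine_of_mem_river (hsq : ¬ IsSquare f.disc) {e : Edge f.aut} (he : e ∈ river f) :
    e.OnSpine := by
  rw [Edge.onSpine_iff_reachable]
  set H := modularGraph f.aut \ SimpleGraph.fromEdgeSet
    {s(Sum.inl e.cross, Sum.inr e.bullet)} with hH
  have hriver : ∀ k, flow^[k] e ∈ river f := fun k => (mapsTo_flow hsq).iterate k he
  -- The flow keeps the same sign on the same side of the river, so it never traverses `e`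
  -- backwards.
  have hsign : ∀ k, 0 < (edgeForm f e).A * (edgeForm f (flow^[k] e)).A := by
    intro k
    induction k with
    | zero => exact mul_self_pos.2 (BQF.A_ne_zero (by rwa [disc_edgeForm]))
    | succ k ih =>
      rw [Function.iterate_succ_apply']
      have := mul_A_flow_pos hsq (flow^[k] e)
      rcases mul_pos_iff.1 ih with ⟨h1, h2⟩ | ⟨h1, h2⟩
      · exact mul_pos h1 (pos_of_mul_pos_right this h2.le)
      · exact mul_pos_of_neg_of_neg h1 (neg_of_mul_pos_right this h2.le)
  have hstep : ∀ k, H.Adj (Sum.inr (flow^[k] e).bullet) (Sum.inl (flow^[k + 1] e).cross) := by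
    intro k
    have hne : (flow^[k + 1] e).next S ≠ e := by
      intro h
      have h1 := hsign (k + 1)
      have h2 := mem_river.1 (hriver (k + 1))
      have h3 := congrArg BQF.A (congrArg (edgeForm f) h)
      rw [edgeForm_next_S] at h3
      simp only at h3
      rw [← h3] at h1
      linarith [mul_comm (edgeForm f (flow^[k + 1] e)).A (edgeForm f (flow^[k + 1] e)).C]
    have := (adj_sdiff_of_ne hsq hne).symm
    rw [Edge.cross_next_S] at this
    rw [Function.iterate_succ_apply'] at this ⊢
    rwa [bullet_next_S_flow] at this
  have hreach : ∀ k, (∀ j, 0 < j → j ≤ k → flow^[j] e ≠ e) →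
      H.Reachable (Sum.inr e.bullet) (Sum.inr (flow^[k] e).bullet) := by
    intro k
    induction k with
    | zero => intro _; exact SimpleGraph.Reachable.refl _
    | succ k ih =>
      intro hk
      exact ((ih fun j hj hjk => hk j hj (hjk.trans k.le_succ)).trans (hstep k).reachable).trans
        (adj_sdiff_of_ne hsq (hk (k + 1) k.succ_pos le_rfl)).reachable
  classical
  have hex := exists_iterate_flow_eq hsq he
  -- Up to the first return the orbit avoids `e`, so it joins the two ends of `e` without using `e`.
  obtain ⟨hpos, hper⟩ := Nat.find_spec hex
  obtain ⟨n, hn⟩ := Nat.exists_eq_succ_of_ne_zero hpos.ne'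
  rw [hn] at hper
  have h1 := (hreach n fun j hj hjn h =>
    Nat.find_min hex (m := j) (by omega) ⟨hj, h⟩).trans (hstep n).reachable
  rw [Nat.succ_eq_add_one] at hper
  rw [hper] at h1
  exact h1.symm

/-- The edges of the part of the modular graph beyond `e`, when `e` is left through its
`•`-vertex. -/
inductive Beyond (e : Edge f.aut) : Edge f.aut → Prop
  | refl : Beyond e e
  | left {d : Edge f.aut} : Beyond e d → Beyond e (d.next (R * S))
  | right {d : Edge f.aut} : Beyond e d → Beyond e (d.next (R ^ 2 * S))

/-- Conway's climbing lemma: each step adds twice an outer coefficient to the middle one, so values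
of one sign keep that sign and the middle coefficient strictly grows. The factor `ε` treats both
signs at once. -/
theorem Beyond.pos {e d : Edge f.aut} (h : Beyond e d) {ε : ℤ} (hA : 0 < ε * (edgeForm f e).A)
    (hB : 0 ≤ ε * (edgeForm f e).B) (hC : 0 < ε * (edgeForm f e).C) :
    0 < ε * (edgeForm f d).A ∧ 0 < ε * (edgeForm f d).C ∧
      (d = e ∨ ε * (edgeForm f e).B < ε * (edgeForm f d).B) := by
  induction h with
  | refl => exact ⟨hA, hC, Or.inl rfl⟩
  | left h ih =>
    obtain ⟨h1, h2, h3⟩ := ih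
    have h4 : ε * (edgeForm f e).B ≤ ε * (edgeForm f _).B := h3.elim (fun h => by rw [h]) le_of_lt
    rw [edgeForm_next_RS]
    exact ⟨h1, by linarith, Or.inr (by linarith)⟩
  | right h ih =>
    obtain ⟨h1, h2, h3⟩ := ih
    have h4 : ε * (edgeForm f e).B ≤ ε * (edgeForm f _).B := h3.elim (fun h => by rw [h]) le_of_lt
    rw [edgeForm_next_R_sq_S]
    exact ⟨by linarith, h2, Or.inr (by linarith)⟩

theorem Beyond.le {e d : Edge f.aut} (h : Beyond e d) {ε : ℤ} (hA : 0 < ε * (edgeForm f e).A)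
    (hB : 0 ≤ ε * (edgeForm f e).B) (hC : 0 < ε * (edgeForm f e).C) :
    ε * (edgeForm f e).B ≤ ε * (edgeForm f d).B :=
  (h.pos hA hB hC).2.2.elim (fun h => by rw [h]) le_of_lt

/-- The vertices of the edges beyond `d`, except for the `⊗`-vertex of `e`. -/
def beyondVertices (d e : Edge f.aut) : Set (CrossVertex f.aut ⊕ BulletVertex f.aut) :=
  {x | ∃ d', Beyond d d' ∧ (x = Sum.inr d'.bullet ∨ d' ≠ e ∧ x = Sum.inl d'.cross)}

/-- With `d = e` the exploration starts at the `•`-end of `e`, with `d = eS` at its `⊗`-end. If no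
step leads back to `e`, it can leave the explored part only through `e`, which is deleted. -/
theorem mem_beyondVertices_of_adj {d e : Edge f.aut} (hde : e = d ∨ e = d.next S)
    (hl : ∀ d', Beyond d d' → d'.next (R * S) ≠ e)
    (hr : ∀ d', Beyond d d' → d'.next (R ^ 2 * S) ≠ e)
    {x y : CrossVertex f.aut ⊕ BulletVertex f.aut} (hx : x ∈ beyondVertices d e)
    (hxy : (modularGraph f.aut \ SimpleGraph.fromEdgeSet
      {s(Sum.inl e.cross, Sum.inr e.bullet)}).Adj x y) : y ∈ beyondVertices d e := by
  rw [SimpleGraph.sdiff_adj, SimpleGraph.fromEdgeSet_adj] at hxy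
  obtain ⟨⟨c, hc⟩, hxy⟩ := hxy
  have hce : c ≠ e := by
    rintro rfl
    rcases hc with ⟨rfl, rfl⟩ | ⟨rfl, rfl⟩ <;> simp at hxy
  obtain ⟨d', hd', hx⟩ := hx
  rcases hc with ⟨rfl, rfl⟩ | ⟨rfl, rfl⟩
  · obtain ⟨hne, hx⟩ : d' ≠ e ∧ d'.cross = c.cross := by simpa [eq_comm] using hx
    rcases Edge.cross_eq_iff.1 hx with rfl | rfl
    · exact ⟨c, hd', Or.inl rfl⟩
    · cases hd' with
      | refl => exact absurd hde (by simp [hne.symm, hce.symm])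
      | left h =>
        rw [← Edge.next_next, Edge.next_S_S, Edge.bullet_next_R]
        exact ⟨_, h, Or.inl rfl⟩
      | right h =>
        rw [← Edge.next_next, Edge.next_S_S, Edge.bullet_next_R_sq]
        exact ⟨_, h, Or.inl rfl⟩
  · have hx : d'.bullet = c.bullet := by simpa [eq_comm] using hx
    rcases Edge.bullet_eq_iff.1 hx with rfl | rfl | rfl
    · exact ⟨c, hd', Or.inr ⟨hce, rfl⟩⟩
    · refine ⟨_, hd'.left, Or.inr ⟨hl d' hd', ?_⟩⟩
      rw [← Edge.next_next, Edge.cross_next_S]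
    · refine ⟨_, hd'.right, Or.inr ⟨hr d' hd', ?_⟩⟩
      rw [← Edge.next_next, Edge.cross_next_S]

theorem mem_of_reachable_of_adj {V : Type*} {G : SimpleGraph V} {s : Set V}
    (hs : ∀ x y, x ∈ s → G.Adj x y → y ∈ s) {x y : V} (h : G.Reachable x y) (hx : x ∈ s) :
    y ∈ s := by
  obtain ⟨p⟩ := h
  induction p with
  | nil => exact hx
  | cons h _ ih => exact ih (hs _ _ hx h)

theorem not_onSpine_of_pos {e : Edge f.aut} {ε : ℤ} (hA : 0 < ε * (edgeForm f e).A)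
    (hC : 0 < ε * (edgeForm f e).C) : ¬ e.OnSpine := by
  rw [Edge.onSpine_iff_reachable]
  intro h
  -- Climbing needs a nonnegative middle coefficient, so the side to explore depends on its sign;
  -- `S` reverses that sign.
  rcases le_or_gt 0 (ε * (edgeForm f e).B) with hB | hB
  · have hcl := mem_of_reachable_of_adj (s := beyondVertices e e) (fun x y hx hxy =>
      mem_beyondVertices_of_adj (Or.inl rfl) (fun d hd h' => by
        have h1 := hd.le hA hB hC
        have h2 := (hd.pos hA hB hC).1
        have h3 := congrArg BQF.B (congrArg (edgeForm f) h')
        rw [edgeForm_next_RS] at h3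
        rw [← h3] at h1
        linarith) (fun d hd h' => by
        have h1 := hd.le hA hB hC
        have h2 := (hd.pos hA hB hC).2.1
        have h3 := congrArg BQF.B (congrArg (edgeForm f) h')
        rw [edgeForm_next_R_sq_S] at h3
        rw [← h3] at h1
        linarith) hx hxy) h.symm ⟨e, .refl, Or.inl rfl⟩
    obtain ⟨d, hd, hx⟩ := hcl
    obtain ⟨hne, hx⟩ : d ≠ e ∧ e.cross = d.cross := by simpa using hx
    rcases Edge.cross_eq_iff.1 hx with rfl | rfl
    · exact hne rfl
    · have h1 := (hd.pos hA hB hC).2.2.resolve_left hne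
      rw [edgeForm_next_S] at h1
      linarith
  · have hA' : 0 < ε * (edgeForm f (e.next S)).A := by rwa [edgeForm_next_S]
    have hC' : 0 < ε * (edgeForm f (e.next S)).C := by rwa [edgeForm_next_S]
    have hB' : ε * (edgeForm f (e.next S)).B = -(ε * (edgeForm f e).B) := by
      rw [edgeForm_next_S]; ring
    have hB'' : 0 ≤ ε * (edgeForm f (e.next S)).B := by linarith
    have hlt : ∀ d, Beyond (e.next S) d → d ≠ e := by
      rintro d hd rfl
      have := hd.le hA' hB'' hC'
      linarith
    have hcl := mem_of_reachable_of_adj (s := beyondVertices (e.next S) e) (fun x y hx hxy =>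
      mem_beyondVertices_of_adj (Or.inr e.next_S_S.symm) (fun d hd => hlt _ hd.left)
        (fun d hd => hlt _ hd.right) hx hxy) h
        ⟨_, .refl, Or.inr ⟨hlt _ .refl, by rw [Edge.cross_next_S]⟩⟩
    obtain ⟨d, hd, hx⟩ := hcl
    have hx : e.bullet = d.bullet := by simpa using hx
    have hle := hd.le hA' hB'' hC'
    rcases Edge.bullet_eq_iff.1 hx with rfl | rfl | rfl
    · exact hlt _ hd rfl
    · rw [hB', edgeForm_next_R] at hle
      linarith
    · rw [hB', edgeForm_next_R_sq] at hle
      linarith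

/-- An edge lies on the spine iff the outer coefficients of its label have opposite signs. -/
theorem onSpine_iff (hsq : ¬ IsSquare f.disc) {e : Edge f.aut} :
    e.OnSpine ↔ (edgeForm f e).A * (edgeForm f e).C < 0 := by
  refine ⟨fun h => ?_, onSpine_of_mem_river hsq⟩
  by_contra! hAC
  have hA := BQF.A_ne_zero (f := edgeForm f e) (by rwa [disc_edgeForm])
  have hC := BQF.C_ne_zero (f := edgeForm f e) (by rwa [disc_edgeForm])
  rcases mul_pos_iff.1 (lt_of_le_of_ne hAC (mul_ne_zero hA hC).symm) with ⟨h1, h2⟩ | ⟨h1, h2⟩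
  · exact not_onSpine_of_pos (ε := 1) (by linarith) (by linarith) h
  · exact not_onSpine_of_pos (ε := -1) (by linarith) (by linarith) h

end Spine

/-! ### Nonnegative matrices and the monoid of forward paths -/

theorem coe_neg_eq (m : SL(2, ℤ)) : ((-m : SL(2, ℤ)) : PSL(2, ℤ)) = m := by
  refine (QuotientGroup.eq.2 ?_).symm
  rw [Matrix.SpecialLinearGroup.mem_center_iff]
  refine ⟨-1, by simp, ?_⟩
  rw [mul_neg, inv_mul_cancel]
  ext i j
  fin_cases i <;> fin_cases j <;> simp

theorem coe_eq_coe_iff {m n : SL(2, ℤ)} :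
    (m : PSL(2, ℤ)) = (n : PSL(2, ℤ)) ↔ n = m ∨ n = -m := by
  constructor
  · intro h
    have h := QuotientGroup.eq.1 h
    obtain ⟨r, hr, h⟩ := Matrix.SpecialLinearGroup.mem_center_iff.1 h
    have hr2 : r ^ 2 = 1 := by simpa using hr
    rcases mul_self_eq_one_iff.1 ((sq r).symm.trans hr2) with rfl | rfl
    · left
      have : m⁻¹ * n = 1 := by
        ext i j
        rw [← h]; fin_cases i <;> fin_cases j <;> simp
      rw [← mul_inv_cancel_left m n, this, mul_one]
    · right
      have : m⁻¹ * n = -1 := by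
        ext i j
        rw [← h]; fin_cases i <;> fin_cases j <;> simp
      rw [← mul_inv_cancel_left m n, this, mul_neg, mul_one]
  · rintro (rfl | rfl)
    · rfl
    · exact (coe_neg_eq m).symm

theorem det_eq_one (m : SL(2, ℤ)) : m 0 0 * m 1 1 - m 0 1 * m 1 0 = 1 := by
  rw [← Matrix.det_fin_two]; exact m.2

/-- All entries are nonnegative. -/
def IsNonneg (m : SL(2, ℤ)) : Prop := 0 ≤ m 0 0 ∧ 0 ≤ m 0 1 ∧ 0 ≤ m 1 0 ∧ 0 ≤ m 1 1

theorem IsNonneg.mul {m n : SL(2, ℤ)} (hm : IsNonneg m) (hn : IsNonneg n) : IsNonneg (m * n) := by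
  obtain ⟨h1, h2, h3, h4⟩ := hm
  obtain ⟨h5, h6, h7, h8⟩ := hn
  refine ⟨?_, ?_, ?_, ?_⟩ <;>
    simp only [Matrix.SpecialLinearGroup.coe_mul, Matrix.mul_apply, Fin.sum_univ_two] <;> positivity

/-- The matrix `(1, 1; 0, 1)`. -/
def matU : SL(2, ℤ) := ⟨!![1, 1; 0, 1], by simp⟩

/-- The matrix `(1, 0; 1, 1)`. -/
def matL : SL(2, ℤ) := ⟨!![1, 0; 1, 1], by simp⟩

theorem R_mul_S : R * S = (matU : PSL(2, ℤ)) := by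
  have h : R * S = ((matR * ModularGroup.S : SL(2, ℤ)) : PSL(2, ℤ)) := rfl
  rw [h, coe_eq_coe_iff]
  right
  ext i j
  fin_cases i <;> fin_cases j <;> decide

theorem R_sq_mul_S : R ^ 2 * S = (matL : PSL(2, ℤ)) := by
  have h : R ^ 2 * S = ((matR ^ 2 * ModularGroup.S : SL(2, ℤ)) : PSL(2, ℤ)) := rfl
  rw [h, coe_eq_coe_iff]
  right
  ext i j
  fin_cases i <;> fin_cases j <;> decide

theorem matU_inv_mul_apply (m : SL(2, ℤ)) :
    (matU⁻¹ * m) 0 0 = m 0 0 - m 1 0 ∧ (matU⁻¹ * m) 0 1 = m 0 1 - m 1 1 ∧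
    (matU⁻¹ * m) 1 0 = m 1 0 ∧ (matU⁻¹ * m) 1 1 = m 1 1 := by
  simp only [Matrix.SpecialLinearGroup.coe_mul, Matrix.SpecialLinearGroup.coe_inv,
    Matrix.adjugate_fin_two, Matrix.mul_apply, Fin.sum_univ_two]
  simp [matU, sub_eq_add_neg]

theorem matL_inv_mul_apply (m : SL(2, ℤ)) :
    (matL⁻¹ * m) 0 0 = m 0 0 ∧ (matL⁻¹ * m) 0 1 = m 0 1 ∧
    (matL⁻¹ * m) 1 0 = m 1 0 - m 0 0 ∧ (matL⁻¹ * m) 1 1 = m 1 1 - m 0 1 := by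
  simp only [Matrix.SpecialLinearGroup.coe_mul, Matrix.SpecialLinearGroup.coe_inv,
    Matrix.adjugate_fin_two, Matrix.mul_apply, Fin.sum_univ_two]
  simp [matL, sub_eq_neg_add]

theorem exists_isNonneg_of_mem_closure {w : PSL(2, ℤ)}
    (hw : w ∈ Submonoid.closure ({R * S, R ^ 2 * S} : Set PSL(2, ℤ))) :
    ∃ m : SL(2, ℤ), IsNonneg m ∧ (m : PSL(2, ℤ)) = w := by
  induction hw using Submonoid.closure_induction with
  | mem x hx =>
    rcases hx with rfl | rfl
    · exact ⟨matU, by simp [IsNonneg, matU], R_mul_S.symm⟩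
    · exact ⟨matL, by simp [IsNonneg, matL], R_sq_mul_S.symm⟩
  | one => exact ⟨1, by simp [IsNonneg], rfl⟩
  | mul x y _ _ hx hy =>
    obtain ⟨m, hm, rfl⟩ := hx
    obtain ⟨n, hn, rfl⟩ := hy
    exact ⟨m * n, hm.mul hn, rfl⟩

/-- Euclid's algorithm on rows: subtracting the smaller row from the larger splits off `matU` or
`matL` and lowers the sum of the entries. -/
theorem mem_closure_of_isNonneg {m : SL(2, ℤ)} (hm : IsNonneg m) :
    (m : PSL(2, ℤ)) ∈ Submonoid.closure ({R * S, R ^ 2 * S} : Set PSL(2, ℤ)) := by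
  have key : ∀ n : ℕ, ∀ m : SL(2, ℤ), IsNonneg m → m 0 0 + m 0 1 + m 1 0 + m 1 1 ≤ n →
      (m : PSL(2, ℤ)) ∈ Submonoid.closure ({R * S, R ^ 2 * S} : Set PSL(2, ℤ)) := by
    intro n
    induction n with
    | zero =>
      intro m ⟨h1, h2, h3, h4⟩ hs
      push_cast at hs
      have h5 : m 0 0 = 0 := by linarith
      have h6 : m 0 1 = 0 := by linarith
      have := det_eq_one m
      simp [h5, h6] at this
    | succ n ih =>
      intro m ⟨h1, h2, h3, h4⟩ hs
      push_cast at hs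
      have hdet := det_eq_one m
      -- If neither row dominates, determinant one leaves only the identity (third case); the fourth
      -- case has determinant at most zero.
      have hcases : (m 1 0 ≤ m 0 0 ∧ m 1 1 ≤ m 0 1) ∨ (m 0 0 ≤ m 1 0 ∧ m 0 1 ≤ m 1 1) ∨
          (m 1 0 < m 0 0 ∧ m 0 1 < m 1 1) ∨ (m 0 0 < m 1 0 ∧ m 1 1 < m 0 1) := by omega
      rcases hcases with ⟨h5, h6⟩ | ⟨h5, h6⟩ | ⟨h5, h6⟩ | ⟨h5, h6⟩
      · have hpos : 0 < m 1 0 + m 1 1 := by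
          by_contra! h
          rw [show m 1 0 = 0 by linarith, show m 1 1 = 0 by linarith] at hdet
          simp at hdet
        have hm : m = matU * (matU⁻¹ * m) := by group
        rw [hm, QuotientGroup.mk_mul, ← R_mul_S]
        obtain ⟨e1, e2, e3, e4⟩ := matU_inv_mul_apply m
        refine mul_mem (Submonoid.subset_closure (by simp)) (ih _ ⟨?_, ?_, ?_, ?_⟩ ?_) <;> linarith
      · have hpos : 0 < m 0 0 + m 0 1 := by
          by_contra! h
          rw [show m 0 0 = 0 by linarith, show m 0 1 = 0 by linarith] at hdet
          simp at hdet
        have hm : m = matL * (matL⁻¹ * m) := by group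
        rw [hm, QuotientGroup.mk_mul, ← R_sq_mul_S]
        obtain ⟨e1, e2, e3, e4⟩ := matL_inv_mul_apply m
        refine mul_mem (Submonoid.subset_closure (by simp)) (ih _ ⟨?_, ?_, ?_, ?_⟩ ?_) <;> linarith
      · have h7 : (m 1 0 + 1) * (m 0 1 + 1) ≤ m 0 0 * m 1 1 :=
          mul_le_mul h5 h6 (by linarith) h1
        have h8 : m 1 0 = 0 := by linarith
        have h9 : m 0 1 = 0 := by linarith
        have h10 : m 0 0 * m 1 1 = 1 := by simpa [h8] using hdet
        have h11 : m 0 0 = 1 := Int.eq_one_of_mul_eq_one_right h1 h10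
        have h12 : m 1 1 = 1 := Int.eq_one_of_mul_eq_one_left h4 h10
        have : m = 1 := by
          ext i j
          fin_cases i <;> fin_cases j <;> simp [h8, h9, h11, h12]
        rw [this]
        exact one_mem _
      · have := mul_le_mul h5.le h6.le h4 h3
        linarith [mul_comm (m 0 1) (m 1 0)]
  have ⟨h1, h2, h3, h4⟩ := hm
  exact key (m 0 0 + m 0 1 + m 1 0 + m 1 1).toNat m hm (by rw [Int.toNat_of_nonneg (by positivity)])

/-- A positive automorphism `M` has a representative of positive trace whose fixed point form is a
positive rational multiple of `f`. -/
theorem IsPositiveAut.exists_matrix {f : BQF} (hf : f.disc ≠ 0) {M : PSL(2, ℤ)}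
    (hM : IsPositiveAut f M) :
    ∃ m : SL(2, ℤ), (m : PSL(2, ℤ)) = M ∧ 0 < m 0 0 + m 1 1 ∧ ∃ k d : ℤ, 0 < k ∧ 0 < d ∧
      k * f.A = d * m 1 0 ∧ k * f.B = d * (m 1 1 - m 0 0) ∧ k * f.C = d * -m 0 1 := by
  obtain ⟨-, m, hm, d, hd, hfm⟩ := hM
  set k : ℤ := (Int.gcd (m 0 1) (Int.gcd (m 1 1 - m 0 0) (m 1 0)) : ℤ) with hk
  have hk1 : k ∣ m 0 1 := Int.gcd_dvd_left ..
  have hk2 : k ∣ Int.gcd (m 1 1 - m 0 0) (m 1 0) := Int.gcd_dvd_right ..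
  have hk3 : k ∣ m 1 1 - m 0 0 := hk2.trans (Int.gcd_dvd_left ..)
  have hk4 : k ∣ m 1 0 := hk2.trans (Int.gcd_dvd_right ..)
  set σ := (m 0 0 + m 1 1).sign with hσ
  have hA : k * f.A = d * (σ * m 1 0) := by
    rw [hfm, formOfMatrix]
    simp only
    rw [mul_left_comm, Int.mul_ediv_cancel' (hk4.mul_left _)]
  have hB : k * f.B = d * (σ * (m 1 1 - m 0 0)) := by
    rw [hfm, formOfMatrix]
    simp only
    rw [mul_left_comm, Int.mul_ediv_cancel' (hk3.mul_left _)]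
  have hC : k * f.C = d * (σ * -m 0 1) := by
    rw [hfm, formOfMatrix]
    simp only
    rw [mul_left_comm, Int.mul_ediv_cancel' ((hk1.neg_right).mul_left _)]
  -- Integer division by zero returns zero, so `k = 0` would make `f` the zero form.
  have hk0 : k ≠ 0 := by
    intro h0
    apply hf
    rw [hfm, formOfMatrix, ← hk, h0]
    simp [BQF.disc]
  have hkpos : 0 < k := lt_of_le_of_ne (by positivity) hk0.symm
  rcases lt_trichotomy (m 0 0 + m 1 1) 0 with h | h | h
  · rw [hσ, Int.sign_eq_neg_one_of_neg h] at hA hB hC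
    refine ⟨-m, by rw [coe_neg_eq, hm], ?_, k, d, hkpos, hd, ?_, ?_, ?_⟩ <;>
      simp only [Matrix.SpecialLinearGroup.coe_neg, Matrix.neg_apply] <;> linarith
  · exfalso
    apply hf
    rw [hσ, h] at hA hB hC
    simp [hk0] at hA hB hC
    simp [BQF.disc, hA, hB]
  · rw [hσ, Int.sign_eq_one_of_pos h] at hA hB hC
    exact ⟨m, hm, h, k, d, hkpos, hd, by linarith, by linarith, by linarith⟩

/-! ### The direction of the spine -/

section Direction

variable {f : BQF}

theorem inv_mul_mul_apply (v m : SL(2, ℤ)) :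
    (v⁻¹ * m * v) 0 0 = v 1 1 * (m 0 0 * v 0 0 + m 0 1 * v 1 0)
      - v 0 1 * (m 1 0 * v 0 0 + m 1 1 * v 1 0) ∧
    (v⁻¹ * m * v) 0 1 = v 1 1 * (m 0 0 * v 0 1 + m 0 1 * v 1 1)
      - v 0 1 * (m 1 0 * v 0 1 + m 1 1 * v 1 1) ∧
    (v⁻¹ * m * v) 1 0 = v 0 0 * (m 1 0 * v 0 0 + m 1 1 * v 1 0)
      - v 1 0 * (m 0 0 * v 0 0 + m 0 1 * v 1 0) ∧
    (v⁻¹ * m * v) 1 1 = v 0 0 * (m 1 0 * v 0 1 + m 1 1 * v 1 1)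
      - v 1 0 * (m 0 0 * v 0 1 + m 0 1 * v 1 1) := by
  refine ⟨?_, ?_, ?_, ?_⟩ <;>
    simp only [Matrix.SpecialLinearGroup.coe_mul, Matrix.SpecialLinearGroup.coe_inv,
      Matrix.adjugate_fin_two, Matrix.mul_apply, Fin.sum_univ_two] <;>
    simp <;> ring

theorem trace_inv_mul_mul (v m : SL(2, ℤ)) :
    (v⁻¹ * m * v) 0 0 + (v⁻¹ * m * v) 1 1 = m 0 0 + m 1 1 := by
  obtain ⟨h1, -, -, h4⟩ := inv_mul_mul_apply v m
  rw [h1, h4]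
  linear_combination (m 0 0 + m 1 1) * det_eq_one v

/-- Conjugation by `W` carries the fixed point form of `M` to that of `W⁻¹MW`, so the label is a
positive rational multiple of the latter. Its outer coefficients are then read off from the
off-diagonal entries of a nonnegative matrix. -/
theorem edgeForm_of_towardBullet (hsq : ¬ IsSquare f.disc) {e : Edge f.aut}
    (h : TowardBullet f e) : 0 < (edgeForm f e).A ∧ (edgeForm f e).C < 0 := by
  have hA0 := BQF.A_ne_zero (f := edgeForm f e) (by rwa [disc_edgeForm])
  have hC0 := BQF.C_ne_zero (f := edgeForm f e) (by rwa [disc_edgeForm])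
  obtain ⟨W, M, rfl, hM, w, hw, hMW⟩ := h
  obtain ⟨m, rfl, htr, k, d, hk, hd, hA, hB, hC⟩ :=
    hM.exists_matrix (fun h0 => hsq (h0 ▸ IsSquare.zero))
  obtain ⟨n, ⟨h1, h2, h3, h4⟩, rfl⟩ := exists_isNonneg_of_mem_closure hw
  induction W using QuotientGroup.induction_on with
  | H v =>
    have hn : ((v⁻¹ * m * v : SL(2, ℤ)) : PSL(2, ℤ)) = (n : PSL(2, ℤ)) := by
      have : (n : PSL(2, ℤ)) = (v : PSL(2, ℤ))⁻¹ * ((m : PSL(2, ℤ)) * (v : PSL(2, ℤ))) := by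
        rw [hMW]; group
      rw [this, ← mul_assoc]
      rfl
    -- The positive trace of `m` decides which of the two lifts is nonnegative.
    have hn : n = v⁻¹ * m * v := by
      rcases coe_eq_coe_iff.1 hn with h | h
      · exact h
      · exfalso
        have htr' := trace_inv_mul_mul v m
        rw [h] at h1 h4
        simp only [Matrix.SpecialLinearGroup.coe_neg, Matrix.neg_apply] at h1 h4
        linarith
    obtain ⟨-, h01, h10, -⟩ := inv_mul_mul_apply v m
    rw [← hn] at h01 h10
    rw [edgeForm_mk, BQF.act_mk] at *
    have hA' : k * (f.comp v).A = d * n 1 0 := by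
      rw [h10]
      simp only [BQF.comp]
      linear_combination v 0 0 ^ 2 * hA + v 0 0 * v 1 0 * hB + v 1 0 ^ 2 * hC
    have hC' : k * (f.comp v).C = -(d * n 0 1) := by
      rw [h01]
      simp only [BQF.comp]
      linear_combination v 0 1 ^ 2 * hA + v 0 1 * v 1 1 * hB + v 1 1 ^ 2 * hC
    constructor
    · refine lt_of_le_of_ne (nonneg_of_mul_nonneg_right (a := k) ?_ hk) hA0.symm
      rw [hA']; positivity
    · refine lt_of_le_of_ne (nonpos_of_mul_nonpos_right (a := k) ?_ hk) hC0
      rw [hC', neg_nonpos]; positivity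

/-- The automorphism of a form given by a solution of Pell's equation `x² - Δ y² = 1`. -/
def pellMatrix (f : BQF) {x y : ℤ} (h : x ^ 2 - f.disc * y ^ 2 = 1) : SL(2, ℤ) :=
  ⟨!![x - f.B * y, -2 * f.C * y; 2 * f.A * y, x + f.B * y], by
    rw [Matrix.det_fin_two_of, ← h, BQF.disc]; ring⟩

theorem comp_pellMatrix {x y : ℤ} (h : x ^ 2 - f.disc * y ^ 2 = 1) :
    f.comp (pellMatrix f h) = f := by
  rw [BQF.disc] at h
  ext <;> simp [BQF.comp, pellMatrix]
  · linear_combination f.A * h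
  · linear_combination f.B * h
  · linear_combination f.C * h

theorem isPositiveAut_pellMatrix (hf : f.disc ≠ 0) {x y : ℤ} (hx : 0 < x) (hy : 0 < y)
    (h : x ^ 2 - f.disc * y ^ 2 = 1) : IsPositiveAut f (pellMatrix f h : PSL(2, ℤ)) := by
  refine ⟨comp_pellMatrix h, _, rfl, ?_⟩
  set m := pellMatrix f h with hm
  have h00 : m 0 0 = x - f.B * y := by simp [hm, pellMatrix]
  have h01 : m 0 1 = 2 * y * -f.C := by simp [hm, pellMatrix]; ring
  have h10 : m 1 0 = 2 * y * f.A := by simp [hm, pellMatrix]; ring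
  have h11 : m 1 1 = x + f.B * y := by simp [hm, pellMatrix]
  have hsub : m 1 1 - m 0 0 = 2 * y * f.B := by rw [h00, h11]; ring
  have hsign : (m 0 0 + m 1 1).sign = 1 := Int.sign_eq_one_of_pos (by rw [h00, h11]; linarith)
  -- The multiplier is the content of `f`: the entries of `m` give `2y * f`, whose gcd is `2y * d`.
  set d : ℤ := (Int.gcd (-f.C) (Int.gcd f.B f.A) : ℤ) with hd
  have hd1 : d ∣ f.C := Int.dvd_neg.1 (Int.gcd_dvd_left ..)
  have hd2 : d ∣ Int.gcd f.B f.A := Int.gcd_dvd_right ..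
  have hd3 : d ∣ f.B := hd2.trans (Int.gcd_dvd_left ..)
  have hd4 : d ∣ f.A := hd2.trans (Int.gcd_dvd_right ..)
  have hd0 : d ≠ 0 := by
    intro h0
    apply hf
    rw [h0, zero_dvd_iff] at hd3 hd4
    simp [BQF.disc, hd3, hd4]
  have hy2 : 0 < 2 * y := by linarith
  have hgcd : (Int.gcd (m 0 1) (Int.gcd (m 1 1 - m 0 0) (m 1 0)) : ℤ) = 2 * y * d := by
    rw [hsub, h01, h10, Int.gcd_mul_left, Nat.cast_mul, Int.natCast_natAbs, abs_of_pos hy2,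
      Int.gcd_mul_left, Nat.cast_mul, Int.natCast_natAbs, abs_of_pos hy2]
  refine ⟨d, lt_of_le_of_ne (by positivity) hd0.symm, ?_⟩
  rw [formOfMatrix, hgcd, hsign, hsub, h01, h10]
  simp only [one_mul, mul_neg, neg_neg]
  simp only [Int.mul_ediv_mul_of_pos _ _ hy2, Int.mul_ediv_cancel' hd4,
    Int.mul_ediv_cancel' hd3, Int.mul_ediv_cancel' hd1]

/-- A positive Pell solution supplies the automorphism. Its conjugate has off-diagonal entries `2yA`
and `-2yC` of the label, both positive, and trace `2x > 0`; determinant one makes the diagonal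
positive too. -/
theorem towardBullet_of_edgeForm (hf : 0 < f.disc) (hsq : ¬ IsSquare f.disc) {e : Edge f.aut}
    (hA : 0 < (edgeForm f e).A) (hC : (edgeForm f e).C < 0) : TowardBullet f e := by
  obtain ⟨x, y, h, hy⟩ : ∃ x y : ℤ, x ^ 2 - f.disc * y ^ 2 = 1 ∧ 0 < x ∧ 0 < y := by
    obtain ⟨x, y, h, hy⟩ := Pell.exists_of_not_isSquare hf hsq
    refine ⟨|x|, |y|, by rwa [sq_abs, sq_abs], abs_pos.2 ?_, abs_pos.2 hy⟩
    rintro rfl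
    nlinarith [mul_nonneg hf.le (sq_nonneg y)]
  obtain ⟨hx, hy⟩ := hy
  obtain ⟨W, rfl⟩ := e.exists_mk
  induction W using QuotientGroup.induction_on with
  | H v =>
    rw [edgeForm_mk, BQF.act_mk] at hA hC
    set m := pellMatrix f h with hm
    have h00 : m 0 0 = x - f.B * y := by simp [hm, pellMatrix]
    have h01 : m 0 1 = -2 * f.C * y := by simp [hm, pellMatrix]
    have h10 : m 1 0 = 2 * f.A * y := by simp [hm, pellMatrix]
    have h11 : m 1 1 = x + f.B * y := by simp [hm, pellMatrix]
    refine ⟨v, m, rfl, isPositiveAut_pellMatrix hf.ne' hx hy h, ((v⁻¹ * m * v : SL(2, ℤ)) : PSL(2, ℤ)),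
      mem_closure_of_isNonneg ?_, ?_⟩
    · obtain ⟨-, e01, e10, -⟩ := inv_mul_mul_apply v m
      have htr := trace_inv_mul_mul v m
      have hdet := det_eq_one (v⁻¹ * m * v)
      generalize v⁻¹ * m * v = n at *
      have e10' : n 1 0 = 2 * y * (f.comp v).A := by
        rw [e10, h00, h01, h10, h11]; simp only [BQF.comp]; ring
      have e01' : n 0 1 = 2 * y * -(f.comp v).C := by
        rw [e01, h00, h01, h10, h11]; simp only [BQF.comp]; ring
      have p10 : 0 < n 1 0 := by rw [e10']; positivity
      have p01 : 0 < n 0 1 := by rw [e01']; exact mul_pos (by positivity) (by linarith)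
      have hprod : 0 < n 0 0 * n 1 1 := by nlinarith [mul_pos p01 p10]
      have hsum : 0 < n 0 0 + n 1 1 := by rw [htr, h00, h11]; linarith
      rcases mul_pos_iff.1 hprod with ⟨q1, q2⟩ | ⟨q1, q2⟩
      · exact ⟨q1.le, p01.le, p10.le, q2.le⟩
      · linarith
    · rw [← QuotientGroup.mk_mul, ← QuotientGroup.mk_mul]
      congr 1
      group

/-- The directed spine runs from `⊗` to `•` through the edges labelled by forms with positive first
and negative last coefficient. -/
theorem towardBullet_iff (hf : 0 < f.disc) (hsq : ¬ IsSquare f.disc) {e : Edge f.aut} :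
    TowardBullet f e ↔ 0 < (edgeForm f e).A ∧ (edgeForm f e).C < 0 :=
  ⟨edgeForm_of_towardBullet hsq, fun h => towardBullet_of_edgeForm hf hsq h.1 h.2⟩

end Direction

/-! ### Branches, Farey components and reduced edges -/

section Reduced

variable {f : BQF}

/-- The branch at a `•`-vertex of the spine points toward the inner boundary iff two of the three
values at the vertex are positive. -/
theorem branchToward_inner_iff (hf : 0 < f.disc) (hsq : ¬ IsSquare f.disc) {e : Edge f.aut}
    (he : (edgeForm f e).A * (edgeForm f e).C < 0) :
    BranchToward f Boundary.inner e.bullet ↔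
      0 < (edgeForm f e).A + (edgeForm f e).B + (edgeForm f e).C := by
  constructor
  · rintro ⟨d, hd, -, hdir, hbr⟩
    rw [towardBullet_iff hf hsq] at hdir
    simp only [onSpine_iff hsq, edgeForm_next_R] at hbr
    have hs : 0 < (edgeForm f d).A + (edgeForm f d).B + (edgeForm f d).C := by
      have := BQF.add_add_ne_zero (f := edgeForm f d) (by rwa [disc_edgeForm])
      by_contra! h
      exact hbr (mul_neg_of_neg_of_pos (lt_of_le_of_ne h this) hdir.1)
    -- Here `d` enters the vertex, `dR` is the branch and so is not on the spine, and `dR²` is the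
    -- exit, whose third value is `d`'s positive first coefficient.
    rcases Edge.bullet_eq_iff.1 hd with rfl | rfl | rfl
    · exact hs
    · rw [edgeForm_next_R] at he
      exact absurd he (not_lt.2 (mul_pos hs hdir.1).le)
    · rw [edgeForm_next_R_sq]
      simp only
      linarith [hdir.1]
  · intro hs
    rcases mul_neg_iff.1 he with ⟨hA, hC⟩ | ⟨hA, hC⟩
    · refine ⟨e, rfl, (onSpine_iff hsq).2 he, (towardBullet_iff hf hsq).2 ⟨hA, hC⟩, ?_⟩
      simp only [onSpine_iff hsq, edgeForm_next_R]
      exact not_lt.2 (mul_pos hs hA).le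
    -- With `A < 0 < C` the spine leaves the vertex through `e`, and the entering edge is `eR`.
    · refine ⟨e.next R, e.bullet_next_R, (onSpine_iff hsq).2 ?_, (towardBullet_iff hf hsq).2 ?_, ?_⟩
      · rw [edgeForm_next_R]
        exact mul_neg_of_pos_of_neg hs hA
      · rw [edgeForm_next_R]
        exact ⟨hs, hA⟩
      · simp only [onSpine_iff hsq, Edge.next_next, ← sq, edgeForm_next_R_sq]
        exact not_lt.2 (mul_pos hC hs).le

theorem branchToward_of_reflTransGen {b : Boundary} {v w : BulletVertex f.aut}
    (hv : BranchToward f b v) (h : Relation.ReflTransGen (Consecutive f b) v w) :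
    BranchToward f b w := by
  cases h with
  | refl => exact hv
  | tail _ h => exact h.2.1

/-- A component ends at the `⊗`-vertex of `e` iff the `•`-vertex beyond it is not inward: an inward
one would be consecutive to that of `e`, and every member of the component is inward. -/
theorem isReducedEdge_iff (hf : 0 < f.disc) (hsq : ¬ IsSquare f.disc) {e : Edge f.aut} :
    IsReducedEdge f e ↔ (edgeForm f e).IsReduced := by
  rw [BQF.isReduced_iff (by rwa [disc_edgeForm]) (by rwa [disc_edgeForm]), IsReducedEdge,
    onSpine_iff hsq]
  refine and_congr_right fun he => ?_
  have heS : (edgeForm f (e.next S)).A * (edgeForm f (e.next S)).C < 0 := by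
    rwa [edgeForm_next_S, mul_comm]
  have hbr := branchToward_inner_iff hf hsq he
  have hbrS := branchToward_inner_iff hf hsq heS
  have hs0 := BQF.add_add_ne_zero (f := edgeForm f (e.next S)) (by rwa [disc_edgeForm])
  have hs : (edgeForm f (e.next S)).A + (edgeForm f (e.next S)).B + (edgeForm f (e.next S)).C =
      (edgeForm f e).A - (edgeForm f e).B + (edgeForm f e).C := by
    rw [edgeForm_next_S]; ring
  rw [hs] at hbrS hs0
  constructor
  · rintro ⟨_, ⟨v, hv, rfl⟩, h1, h2⟩
    have hin := branchToward_of_reflTransGen hv h1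
    refine ⟨hbr.1 hin, ?_⟩
    by_contra! h
    refine h2 (Relation.ReflTransGen.tail h1 ⟨hin, hbrS.2 (lt_of_le_of_ne h hs0.symm), e,
      (onSpine_iff hsq).2 he, rfl, rfl⟩)
  · rintro ⟨h1, h2⟩
    refine ⟨_, ⟨e.bullet, hbr.2 h1, rfl⟩, Relation.ReflTransGen.refl, fun h => ?_⟩
    exact h2.not_gt (hbrS.1 (branchToward_of_reflTransGen (hbr.2 h1) h))

end Reduced

end Cark

theorem mainTheorem1 (f : Cark.BQF) (hf : 0 < f.disc) (hsq : ¬ IsSquare f.disc) :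
    Set.BijOn (Cark.edgeForm f) {e | Cark.IsReducedEdge f e} {g | g ∈ f.formClass ∧ g.IsReduced} := by
  refine ⟨fun e he => ⟨?_, (Cark.isReducedEdge_iff hf hsq).1 he⟩, Cark.edgeForm_injective.injOn, ?_⟩
  · obtain ⟨W, rfl⟩ := e.exists_mk
    exact ⟨W, rfl⟩
  · rintro _ ⟨⟨W, rfl⟩, h⟩
    exact ⟨Cark.Edge.mk W, (Cark.isReducedEdge_iff hf hsq).2 h, rfl⟩
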